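/- **Setting.** Let $T\in\mathbb N$, $d\in\mathbb N$, and let $\Omega_1,\dots,\Omega_T$ be Polish spaces. Put $\Omega^t:=\Omega_1\times\dots\times\Omega_t$ ($\Omega^0$ is a singleton) and write $\omega^t=(\omega_1,\dots,\omega_t)=(\omega^{t-1},\omega_t)$. For a Polish space $X$ let $\mathcal B(X)$ be its Borel $\sigma$-algebra, $\mathfrak P(X)$ the set of Borel probability measures on $X$ with the weak topology, and $\mathcal B_c(X):=\bigcap_{P\in\mathfrak P(X)}\mathcal B_P(X)$ the universal $\sigma$-algebra, where $\mathcal B_P(X)$ is the $P$-completion of $\mathcal B(X)$. Measures are extended to $\mathcal B_c$ without change of notation. On $\mathbb R^d$, $hy$ is the scalar product and $|\cdot|$ the Euclidean norm. *Models.* For $0\le t\le T-1$ and $\omega^t\in\Omega^t$ let $\mathcal Q_{t+1}(\omega^t)\subset\mathfrak P(\Omega_{t+1})$ be non-empty and convex, and assume that the graph $\{(\omega^t,P):P\in\mathcal Q_{t+1}(\omega^t)\}$ is an analytic subset of $\Omega^t\times\mathfrak P(\Omega_{t+1})$ for every $t$. Let $\mathcal Q^T$ be the set of all measures $P=P_1\otimes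 q_2\otimes\dots\otimes q_T$ on $\Omega^T$, where $P_1\in\mathcal Q_1$, each $q_{s+1}(\cdot,\omega^s)$ ($1\le s\le T-1$) is a $\mathcal B_c(\Omega^s)$-measurable stochastic kernel on $\Omega_{s+1}$ given $\Omega^s$, and $q_{s+1}(\cdot,\omega^s)\in\mathcal Q_{s+1}(\omega^s)$ for $P_s$-almost every $\omega^s$. Here $P_s:=P_1\otimes q_2\otimes\dots\otimes q_s$, with $P_{s}\otimes q_{s+1}(A)=\int_{\Omega^s}\int_{\Omega_{s+1}}1_A(\omega^s,\omega_{s+1})\,q_{s+1}(d\omega_{s+1},\omega^s)\,P_s(d\omega^s)$. We write $q_1:=P_1$ and let $P_0$ be the unit mass on $\Omega^0$. *Prices and strategies.* For $0\le t\le T$ let $S_t:\Omega^t\to\mathbb R^d$ be Borel measurable, and let $\Delta S_{t+1}(\omega^t,\omega_{t+1}):=S_{t+1}(\omega^t,\omega_{t+1})-S_t(\omega^t)$. Let $\Phi$ be the set of all $\phi=(\phi_t)_{1\le t\le T}$ with $\phi_t:\Omega^{t-1}\to\mathbb R^d$ being $\mathcal B_c(\Omega^{t-1})$-measurable, and let $V_T^{0,\phi}:=\sum_{s=1}^T\phi_s\Delta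 S_s$. *Strong no-arbitrage* $sNA(\mathcal Q^T)$: for all $P\in\mathcal Q^T$ and $\phi\in\Phi$, if $V_T^{0,\phi}\ge0$ $P$-a.s., then $V_T^{0,\phi}=0$ $P$-a.s. For $P=P_1\otimes q_2\otimes\dots\otimes q_T\in\mathcal Q^T$ as above and $0\le t\le T-1$ let $$D_P^{t+1}(\omega^t):=\mathrm{Aff}\Big(\bigcap\big\{A\subset\mathbb R^d\text{ closed}:\ q_{t+1}\big(\Delta S_{t+1}(\omega^t,\cdot)\in A,\ \omega^t\big)=1\big\}\Big),$$ where $\mathrm{Aff}$ denotes the affine hull. **Proposition 2.3.** Assume that $sNA(\mathcal Q^T)$ holds. Let $0\le t\le T-1$ and fix $P=P_1\otimes q_2\otimes\dots\otimes q_T\in\mathcal Q^T$. Then there exist a set $\Omega_P^t\in\mathcal B(\Omega^t)$ with $P_t(\Omega_P^t)=1$ and a $\mathcal B(\Omega^t)$-measurable function $\alpha_t^P:\Omega^t\to(0,1]$ such that for all $\omega^t\in\Omega_P^t$ and all $h\in D_P^{t+1}(\omega^t)$, $$q_{t+1}\big(h\,\Delta S_{t+1}(\omega^t,\cdot)\le-\alpha_t^P(\omega^t)\,|h|,\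 \omega^t\big)\ \ge\ \alpha_t^P(\omega^t).$$ -/

import Mathlib

open MeasureTheory
open scoped NNReal ENNReal

namespace RobustMarket

/-- The universal sigma-algebra `B_c(X) = ⋂_P B_P(X)`: the sets that belong to the `P`-completion of
the given (Borel) sigma-algebra for every probability measure `P`. -/
@[reducible]
def univSigma (X : Type*) [MeasurableSpace X] : MeasurableSpace X where
  MeasurableSet' A := ∀ P : ProbabilityMeasure X, NullMeasurableSet A (P : Measure X)
  measurableSet_empty _ := MeasurableSet.empty.nullMeasurableSet
  measurableSet_compl _ hA P := (hA P).compl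
  measurableSet_iUnion _ hA P := NullMeasurableSet.iUnion fun i => hA i P

/-- Universally measurable maps. -/
def UnivMeasurable {X Y : Type*} [MeasurableSpace X] [MeasurableSpace Y] (f : X → Y) : Prop :=
  Measurable[univSigma X] f

/-- The path space `Ω^t = Ω_1 × ⋯ × Ω_t`. The `(i+1)`-st factor `Ω_{i+1}` is written `Ω i`;
`Path Ω 0` is a singleton. -/
abbrev Path (Ω : ℕ → Type*) (t : ℕ) : Type _ := (i : Fin t) → Ω i

/-- The path `(ω^t, ω_{t+1})`. -/
def Path.snoc {Ω : ℕ → Type*} {t : ℕ} (ω : Path Ω t) (x : Ω t) : Path Ω (t + 1) :=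
  Fin.snoc (α := fun i : Fin (t + 1) => Ω i) ω x

/-- The restriction `ω^s` of the path `ω^t`, for `s ≤ t`. -/
def Path.past {Ω : ℕ → Type*} {s t : ℕ} (h : s ≤ t) (ω : Path Ω t) : Path Ω s :=
  fun i => ω ⟨i, i.isLt.trans_le h⟩

/-- The measure `μ ⊗ p` on `Ω^{t+1}`, for a measure `μ` on `Ω^t` and a stochastic kernel `p` on
`Ω_{t+1}` given `Ω^t`. See `prodKernel_apply` for the integral formula. -/
noncomputable def prodKernel {Ω : ℕ → Type*} [∀ i, MeasurableSpace (Ω i)] {t : ℕ}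
    (μ : Measure (Path Ω t)) (p : Path Ω t → ProbabilityMeasure (Ω t)) :
    Measure (Path Ω (t + 1)) :=
  μ.bind fun ω => (p ω : Measure (Ω t)).map ω.snoc

/-- `P_t = q_1 ⊗ q_2 ⊗ ⋯ ⊗ q_t`. The kernel on `Ω_{t+1}` given `Ω^t` is written `q t`; in particular
`q 0` at the only point of `Ω^0` is the initial law `P_1`, and `law q 1` is `P_1`. -/
noncomputable def law {Ω : ℕ → Type*} [∀ i, MeasurableSpace (Ω i)]
    (q : ∀ t, Path Ω t → ProbabilityMeasure (Ω t)) : ∀ t, Measure (Path Ω t)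
  | 0 => Measure.dirac fun i => i.elim0
  | t + 1 => prodKernel (law q t) (q t)

section facts

theorem UnivMeasurable.nullMeasurable {X Y : Type*} [MeasurableSpace X] [MeasurableSpace Y]
    {f : X → Y} (hf : UnivMeasurable f) (μ : Measure X) [IsProbabilityMeasure μ] :
    NullMeasurable f μ :=
  fun _ hs => hf hs ⟨μ, inferInstance⟩

/-- The evaluation sigma-algebra on `𝔓(Y)` is countably generated if that of `Y` is. -/
theorem countablyGenerated_probabilityMeasure (Y : Type*) [MeasurableSpace Y]
    [h : MeasurableSpace.CountablyGenerated Y] :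
    MeasurableSpace.CountablyGenerated (ProbabilityMeasure Y) := by
  obtain ⟨b, hb, hgen⟩ := h.isCountablyGenerated
  have hA : (generateSetAlgebra b).Countable := countable_generateSetAlgebra hb
  have : Countable (generateSetAlgebra b) := hA.to_subtype
  have hgen' : ‹MeasurableSpace Y› = .generateFrom (generateSetAlgebra b) := by
    rw [generateFrom_generateSetAlgebra_eq, hgen]
  let e : ProbabilityMeasure Y → (generateSetAlgebra b → ℝ≥0∞) :=
    fun μ C => (μ : Measure Y) C
  have key : (inferInstance : MeasurableSpace (ProbabilityMeasure Y)) =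
      MeasurableSpace.comap e inferInstance := by
    apply le_antisymm
    · have h1 : Measurable[MeasurableSpace.comap e inferInstance]
          (fun μ : ProbabilityMeasure Y => (μ : Measure Y)) := by
        refine @Measurable.measure_of_isPiSystem_of_isProbabilityMeasure _ _
          (MeasurableSpace.comap e inferInstance) _ _ _ _ hgen' ?_ ?_
        · exact fun s hs t ht _ => isSetAlgebra_generateSetAlgebra.inter_mem hs ht
        · intro s hs
          have h2 : Measurable[MeasurableSpace.comap e inferInstance] e :=
            comap_measurable e
          exact (measurable_pi_apply (⟨s, hs⟩ : generateSetAlgebra b)).comp h2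
      exact h1.comap_le
    · refine Measurable.comap_le ?_
      refine measurable_pi_lambda _ fun C => ?_
      refine (Measure.measurable_coe ?_).comp measurable_subtype_coe
      rw [hgen']
      exact MeasurableSpace.measurableSet_generateFrom C.2
  have h3 := MeasurableSpace.CountablyGenerated.comap e
  rwa [← key] at h3

/-- A universally measurable kernel agrees almost everywhere with a Borel kernel. -/
theorem UnivMeasurable.aemeasurable_kernel {X Y : Type*} [MeasurableSpace X] [MeasurableSpace Y]
    [MeasurableSpace.CountablyGenerated Y] {p : X → ProbabilityMeasure Y} (hp : UnivMeasurable p)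
    (μ : Measure X) [IsProbabilityMeasure μ] :
    AEMeasurable p μ :=
  have := countablyGenerated_probabilityMeasure Y
  (hp.nullMeasurable μ).aemeasurable

theorem Path.measurable_snoc {Ω : ℕ → Type*} [∀ i, MeasurableSpace (Ω i)] {t : ℕ} :
    Measurable fun z : Path Ω t × Ω t => z.1.snoc z.2 := by
  refine measurable_pi_lambda _ fun i => ?_
  refine Fin.lastCases ?_ (fun j => ?_) i
  · simp only [Path.snoc, Fin.snoc_last]
    exact (measurable_snd : Measurable fun z : Path Ω t × Ω t => z.2)
  · simp only [Path.snoc, Fin.snoc_castSucc]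
    exact (measurable_pi_apply j).comp measurable_fst

theorem Path.aemeasurable_map_snoc {Ω : ℕ → Type*} [∀ i, MeasurableSpace (Ω i)] {t : ℕ}
    [MeasurableSpace.CountablyGenerated (Ω t)]
    (μ : Measure (Path Ω t)) [IsProbabilityMeasure μ] {p : Path Ω t → ProbabilityMeasure (Ω t)}
    (hp : UnivMeasurable p) :
    AEMeasurable (fun ω => (p ω : Measure (Ω t)).map ω.snoc) μ := by
  obtain ⟨p', hp', he⟩ := hp.aemeasurable_kernel μ
  refine ⟨fun ω => (p' ω : Measure (Ω t)).map ω.snoc, ?_, ?_⟩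
  · refine Measure.measurable_of_measurable_coe _ fun A hA => ?_
    let κ : ProbabilityTheory.Kernel (Path Ω t) (Ω t) :=
      ⟨fun ω => (p' ω : Measure (Ω t)), measurable_subtype_coe.comp hp'⟩
    have hκ : ProbabilityTheory.IsMarkovKernel κ := ⟨fun ω => (p' ω).2⟩
    have h1 := ProbabilityTheory.Kernel.measurable_kernel_prodMk_left (κ := κ)
      (Path.measurable_snoc (Ω := Ω) (t := t) hA)
    have h2 : ∀ ω : Path Ω t, Measurable (ω.snoc : Ω t → Path Ω (t + 1)) := fun ω =>
      Path.measurable_snoc.comp measurable_prodMk_left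
    simp_rw [Measure.map_apply (h2 _) hA]
    exact h1
  · filter_upwards [he] with ω hω
    rw [hω]

theorem prodKernel_apply {Ω : ℕ → Type*} [∀ i, MeasurableSpace (Ω i)] {t : ℕ}
    [MeasurableSpace.CountablyGenerated (Ω t)]
    (μ : Measure (Path Ω t)) [IsProbabilityMeasure μ] {p : Path Ω t → ProbabilityMeasure (Ω t)}
    (hp : UnivMeasurable p) {A : Set (Path Ω (t + 1))} (hA : MeasurableSet A) :
    prodKernel μ p A = ∫⁻ ω, (p ω : Measure (Ω t)) {x | ω.snoc x ∈ A} ∂μ := by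
  have h2 : ∀ ω : Path Ω t, Measurable (ω.snoc : Ω t → Path Ω (t + 1)) := fun ω =>
    Path.measurable_snoc.comp measurable_prodMk_left
  rw [prodKernel, Measure.bind_apply hA (Path.aemeasurable_map_snoc μ hp)]
  simp_rw [Measure.map_apply (h2 _) hA]
  rfl

theorem isProbabilityMeasure_law {Ω : ℕ → Type*} [∀ i, MeasurableSpace (Ω i)]
    [∀ i, MeasurableSpace.CountablyGenerated (Ω i)]
    (q : ∀ t, Path Ω t → ProbabilityMeasure (Ω t)) :
    ∀ t, (∀ s < t, UnivMeasurable (q s)) → IsProbabilityMeasure (law q t)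
  | 0, _ => by unfold law; infer_instance
  | t + 1, hq => by
    have := isProbabilityMeasure_law q t fun s hs => hq s (hs.trans t.lt_succ_self)
    refine ⟨?_⟩
    rw [law, prodKernel_apply _ (hq t t.lt_succ_self) MeasurableSet.univ]
    simp

end facts

/-- The sets of one-period models `𝒬_{t+1}(ω^t) ⊆ 𝔓(Ω_{t+1})`, written `𝒬 t ω`, are non-empty and
convex for `0 ≤ t ≤ T - 1`, and their graphs are analytic in `Ω^t × 𝔓(Ω_{t+1})`, where
`𝔓(Ω_{t+1})` carries the weak topology. -/
structure IsAdmissiblePriors {Ω : ℕ → Type*} [∀ i, TopologicalSpace (Ω i)]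
    [∀ i, MeasurableSpace (Ω i)] [∀ i, BorelSpace (Ω i)] (T : ℕ)
    (𝒬 : ∀ t, Path Ω t → Set (ProbabilityMeasure (Ω t))) : Prop where
  nonempty : ∀ t < T, ∀ ω, (𝒬 t ω).Nonempty
  convex : ∀ t < T, ∀ ω,
    Convex ℝ≥0 ((fun P : ProbabilityMeasure (Ω t) => (P : Measure (Ω t))) '' 𝒬 t ω)
  analytic_graph : ∀ t < T,
    AnalyticSet {z : Path Ω t × ProbabilityMeasure (Ω t) | z.2 ∈ 𝒬 t z.1}

/-- The kernels `q_1, …, q_T` are universally measurable and `q_{t+1}(·, ω^t) ∈ 𝒬_{t+1}(ω^t)` for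
`P_t`-almost every `ω^t`. -/
structure IsSelection {Ω : ℕ → Type*} [∀ i, MeasurableSpace (Ω i)] (T : ℕ)
    (𝒬 : ∀ t, Path Ω t → Set (ProbabilityMeasure (Ω t)))
    (q : ∀ t, Path Ω t → ProbabilityMeasure (Ω t)) : Prop where
  univMeasurable : ∀ t < T, UnivMeasurable (q t)
  ae_mem : ∀ t < T, ∀ᵐ ω ∂law q t, q t ω ∈ 𝒬 t ω

/-- The set `𝒬^T` of all product measures `q_1 ⊗ q_2 ⊗ ⋯ ⊗ q_T` of selections. -/
def models {Ω : ℕ → Type*} [∀ i, MeasurableSpace (Ω i)] (T : ℕ)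
    (𝒬 : ∀ t, Path Ω t → Set (ProbabilityMeasure (Ω t))) : Set (Measure (Path Ω T)) :=
  {P | ∃ q, IsSelection T 𝒬 q ∧ P = law q T}

/-- The increment `ΔS_{t+1}(ω^t, ω_{t+1}) = S_{t+1}(ω^t, ω_{t+1}) - S_t(ω^t)`. -/
noncomputable def increment {Ω : ℕ → Type*} {d : ℕ}
    (S : ∀ t, Path Ω t → EuclideanSpace ℝ (Fin d)) {t : ℕ} (ω : Path Ω t) (x : Ω t) :
    EuclideanSpace ℝ (Fin d) :=
  S (t + 1) (ω.snoc x) - S t ω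

/-- Trading strategies up to time `T`: universally predictable processes. The holdings `φ_{t+1}`,
chosen at time `t` and applied to `ΔS_{t+1}`, are written `φ t : Ω^t → ℝ^d`. -/
def IsStrategy {Ω : ℕ → Type*} [∀ i, MeasurableSpace (Ω i)] {d : ℕ} (T : ℕ)
    (φ : ∀ t, Path Ω t → EuclideanSpace ℝ (Fin d)) : Prop :=
  ∀ t < T, UnivMeasurable (φ t)

/-- The value `V_t^{x,φ} = x + ∑_{s=1}^t φ_s ΔS_s` of a self-financing portfolio. -/
noncomputable def portfolioValue {Ω : ℕ → Type*} {d : ℕ}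
    (S φ : ∀ t, Path Ω t → EuclideanSpace ℝ (Fin d)) (x : ℝ) (t : ℕ) (ω : Path Ω t) : ℝ :=
  x + ∑ s : Fin t, inner ℝ (φ s (ω.past s.isLt.le)) (increment S (ω.past s.isLt.le) (ω s))

/-- The strong no-arbitrage condition `sNA(𝒬^T)`. -/
def StrongNoArbitrage {Ω : ℕ → Type*} [∀ i, MeasurableSpace (Ω i)] {d : ℕ} (T : ℕ)
    (𝒬 : ∀ t, Path Ω t → Set (ProbabilityMeasure (Ω t)))
    (S : ∀ t, Path Ω t → EuclideanSpace ℝ (Fin d)) : Prop :=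
  ∀ P ∈ models T 𝒬, ∀ φ : ∀ t, Path Ω t → EuclideanSpace ℝ (Fin d), IsStrategy T φ →
    (∀ᵐ ω ∂P, 0 ≤ portfolioValue S φ 0 T ω) → ∀ᵐ ω ∂P, portfolioValue S φ 0 T ω = 0

/-- `D_P^{t+1}(ω^t)`: the affine hull of the intersection of all closed sets `A ⊆ ℝ^d` with
`q_{t+1}(ΔS_{t+1}(ω^t, ·) ∈ A, ω^t) = 1`. -/
noncomputable def supportHull {Ω : ℕ → Type*} [∀ i, MeasurableSpace (Ω i)] {d : ℕ}
    (S : ∀ t, Path Ω t → EuclideanSpace ℝ (Fin d))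
    (q : ∀ t, Path Ω t → ProbabilityMeasure (Ω t)) (t : ℕ) (ω : Path Ω t) :
    AffineSubspace ℝ (EuclideanSpace ℝ (Fin d)) :=
  affineSpan ℝ (⋂₀ {A : Set (EuclideanSpace ℝ (Fin d)) |
    IsClosed A ∧ (q t ω : Measure (Ω t)) {x | increment S ω x ∈ A} = 1})

end RobustMarket

/-!
For a law `ν` on `ℝ^d` let `g(h) = ∫ (h·y)⁻ / (1 + |y|) ν(dy)` be the damped expected shortfall. It
is finite and continuous, and its zero set `K` is the closed convex cone of the positions `h` with
`h·y ≥ 0` almost surely. Below, `ν` is the conditional law of `ΔS_{t+1}` given `ω^t`, for a Borel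
version of the kernel `q_{t+1}`, and `g`, `K` depend on `ω^t`.

*No arbitrage in one period, for almost every path.* The strong no-arbitrage condition speaks of
measurable strategies, so a position in `K` has to be selected measurably that is an arbitrage
whenever one exists. The projection `s` of the damped mean `m = ∫ y / (1 + |y|) ν(dy)` onto `K` does
this: it is measurable as the unique zero of a nonnegative Carathéodory function
(`exists_measurable_projection_zeros`), so that trading `s` between `t` and `t + 1` only is a
strategy, and `s·y = 0` almost surely (`StrongNoArbitrage.ae_inner_increment_eq_zero`). Then
`|s|² = s·m = 0`, so `m` lies in the polar cone of `K`, and each `k ∈ K` satisfies `k·m = 0`, that is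
`k·y = 0` almost surely (`ae_inner_eq_zero_of_projection`).

*The quantitative bound.* On the compact set of unit vectors at distance at least `1` from `K`, the
continuous function `g` has no zero, hence `g > 1 / (n + 1)` there for some `n`
(`exists_shortfallBound`). The set of paths for which a given `n` works is Borel, again because
zeros of Carathéodory functions on compact sets are detected by countable dense sets
(`measurableSet_shortfallBound`), so the least such `n` is a Borel function of the path, and so is
`α = 1 / (2 (n + 1))`. Since the elements of `K` vanish on the increments, the affine hull
`D_P^{t+1}` is orthogonal to `K` (`inner_eq_zero_of_mem_supportHull`); therefore a unit vector `h` of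
it has distance `1` to `K`, and `2 α < g(h) ≤ α + ν(h·y ≤ -α)`.
-/

namespace RobustMarket

open ProbabilityTheory Metric

/-! ### Zero sets of Carathéodory functions -/

section zeroSet

variable {X E : Type*} [MeasurableSpace X]

/-- By compactness, `F ω` has a zero on `C` iff its values on a countable dense subset of `C` come
arbitrarily close to `0`. -/
theorem measurableSet_exists_mem_eq_zero [PseudoMetricSpace E] [SecondCountableTopology E]
    {F : X → E → ℝ} (hm : ∀ h, Measurable fun ω => F ω h) (hc : ∀ ω, Continuous (F ω))
    (h0 : ∀ ω h, 0 ≤ F ω h) {C : Set E} (hC : IsCompact C) :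
    MeasurableSet {ω | ∃ h ∈ C, F ω h = 0} := by
  rcases C.eq_empty_or_nonempty with rfl | hne
  · simp
  have : Nonempty C := hne.to_subtype
  let u : ℕ → C := TopologicalSpace.denseSeq C
  have hu : DenseRange u := TopologicalSpace.denseRange_denseSeq C
  have key : {ω | ∃ h ∈ C, F ω h = 0} = ⋂ n : ℕ, ⋃ k, {ω | F ω (u k) < 1 / ((n : ℝ) + 1)} := by
    ext ω
    simp only [Set.mem_ofPred_eq, Set.mem_iInter, Set.mem_iUnion]
    constructor
    · rintro ⟨h, hh, hz⟩ n
      have ho : IsOpen {c : C | F ω c < 1 / ((n : ℝ) + 1)} :=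
        isOpen_lt ((hc ω).comp continuous_subtype_val) continuous_const
      exact hu.exists_mem_open ho ⟨⟨h, hh⟩, by rw [Set.mem_ofPred_eq, hz]; positivity⟩
    · intro hn
      obtain ⟨h, hh, hmin⟩ := hC.exists_isMinOn hne (hc ω).continuousOn
      refine ⟨h, hh, le_antisymm (le_of_forall_pos_le_add fun ε hε => ?_) (h0 ω h)⟩
      obtain ⟨n, hlt⟩ := exists_nat_one_div_lt hε
      obtain ⟨k, hk⟩ := hn n
      have := hmin (u k).2
      simp only [Set.mem_ofPred_eq] at this
      linarith
  rw [key]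
  exact .iInter fun n => .iUnion fun k => measurableSet_lt (hm _) measurable_const

theorem measurable_infDist_zeros [PseudoMetricSpace E] [ProperSpace E]
    {F : X → E → ℝ} (hm : ∀ h, Measurable fun ω => F ω h) (hc : ∀ ω, Continuous (F ω))
    (h0 : ∀ ω h, 0 ≤ F ω h) (hz : ∀ ω, ∃ h, F ω h = 0) (h : E) :
    Measurable fun ω => infDist h {k | F ω k = 0} := by
  refine measurable_of_Iic fun r => ?_
  convert measurableSet_exists_mem_eq_zero hm hc h0 (isCompact_closedBall h r) using 1
  ext ω
  simp only [Set.mem_preimage, Set.mem_Iic, Set.mem_ofPred_eq, mem_closedBall]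
  constructor
  · intro hr
    obtain ⟨k, hk, he⟩ := (isClosed_eq (hc ω) continuous_const).exists_infDist_eq_dist (hz ω) h
    exact ⟨k, by rwa [dist_comm, ← he], hk⟩
  · rintro ⟨k, hr, hk⟩
    exact (infDist_le_dist_of_mem (s := {k | F ω k = 0}) hk).trans (by rwa [dist_comm])

/-- The event `s ω ∈ C`, for closed `C`, is the event that `F ω` has a zero in one of the countably
many compact sets that exhaust `C`. -/
theorem measurable_of_unique_zero [PseudoMetricSpace E] [ProperSpace E] [MeasurableSpace E]
    [BorelSpace E]
    {F : X → E → ℝ} (hm : ∀ h, Measurable fun ω => F ω h) (hc : ∀ ω, Continuous (F ω))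
    (h0 : ∀ ω h, 0 ≤ F ω h) {s : X → E} (hs : ∀ ω h, F ω h = 0 ↔ h = s ω) :
    Measurable s := by
  refine measurable_of_isClosed fun C hC => ?_
  have key : s ⁻¹' C = ⋃ n, {ω | ∃ h ∈ C ∩ compactCovering E n, F ω h = 0} := by
    ext ω
    simp only [hs, exists_eq_right, Set.mem_preimage, Set.mem_iUnion, Set.mem_ofPred_eq]
    constructor
    · intro h
      obtain ⟨n, hn⟩ := Set.mem_iUnion.1 ((iUnion_compactCovering E).symm ▸ Set.mem_univ (s ω))
      exact ⟨n, h, hn⟩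
    · rintro ⟨n, h, -⟩
      exact h
  rw [key]
  exact .iUnion fun n =>
    measurableSet_exists_mem_eq_zero hm hc h0 ((isCompact_compactCovering E n).inter_left hC)

theorem measurable_comp_of_continuous_of_measurable [PseudoMetricSpace E] [T0Space E]
    [SecondCountableTopology E] [MeasurableSpace E] [BorelSpace E] {u : E → X → ℝ}
    (hc : ∀ ω, Continuous fun h => u h ω) (hm : ∀ h, Measurable (u h))
    {m : X → E} (hmeas : Measurable m) : Measurable fun ω => u (m ω) ω := by
  have hu := measurable_uncurry_of_continuous_of_measurable hc hm
  exact hu.comp (hmeas.prodMk measurable_id)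

theorem inner_sub_nonpos_of_dist_eq_infDist [NormedAddCommGroup E] [InnerProductSpace ℝ E]
    {Z : Set E} (hZ : Convex ℝ Z) {m v k : E} (hv : v ∈ Z) (he : infDist m Z = dist m v)
    (hk : k ∈ Z) : inner ℝ (m - v) (k - v) ≤ 0 := by
  refine (norm_eq_iInf_iff_real_inner_le_zero hZ hv).1 ?_ k hk
  rw [← dist_eq_norm, ← he, infDist_eq_iInf]
  exact iInf_congr fun w => dist_eq_norm _ _

/-- The nearest point of a convex set is unique: two of them satisfy each other's variational
inequality. -/
theorem eq_of_dist_eq_infDist_of_convex [NormedAddCommGroup E] [InnerProductSpace ℝ E]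
    {Z : Set E} (hZ : Convex ℝ Z) {m v w : E} (hv : v ∈ Z) (hw : w ∈ Z)
    (hvd : infDist m Z = dist m v) (hwd : infDist m Z = dist m w) : v = w := by
  have h1 := inner_sub_nonpos_of_dist_eq_infDist hZ hv hvd hw
  have h2 := inner_sub_nonpos_of_dist_eq_infDist hZ hw hwd hv
  have h3 : inner ℝ (m - v) (w - v) + inner ℝ (m - w) (v - w) = ‖v - w‖ ^ 2 := by
    rw [← neg_sub v w, inner_neg_right, neg_add_eq_sub, ← inner_sub_left,
      sub_sub_sub_cancel_left, real_inner_self_eq_norm_sq]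
  have h4 : ‖v - w‖ = 0 := by
    have := norm_nonneg (v - w)
    nlinarith
  exact sub_eq_zero.1 (norm_eq_zero.1 h4)

/-- The metric projection of a measurable map onto a measurable family of closed convex sets is
measurable; it is written through its variational inequality. -/
theorem exists_measurable_projection_zeros [NormedAddCommGroup E] [InnerProductSpace ℝ E]
    [FiniteDimensional ℝ E] [MeasurableSpace E] [BorelSpace E]
    {F : X → E → ℝ} (hm : ∀ h, Measurable fun ω => F ω h) (hc : ∀ ω, Continuous (F ω))
    (h0 : ∀ ω h, 0 ≤ F ω h) (hz : ∀ ω, ∃ h, F ω h = 0) (hconv : ∀ ω, Convex ℝ {h | F ω h = 0})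
    {m : X → E} (hmeas : Measurable m) :
    ∃ s : X → E, Measurable s ∧ (∀ ω, F ω (s ω) = 0) ∧
      ∀ ω k, F ω k = 0 → inner ℝ (m ω - s ω) (k - s ω) ≤ 0 := by
  have : ProperSpace E := FiniteDimensional.proper_real E
  let Z : X → Set E := fun ω => {h | F ω h = 0}
  have hex : ∀ ω, ∃ v ∈ Z ω, infDist (m ω) (Z ω) = dist (m ω) v := fun ω =>
    (isClosed_eq (hc ω) continuous_const).exists_infDist_eq_dist (hz ω) (m ω)
  choose s hsZ hsd using hex
  refine ⟨s, ?_, hsZ, fun ω k hk =>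
    inner_sub_nonpos_of_dist_eq_infDist (hconv ω) (hsZ ω) (hsd ω) hk⟩
  have hd : Measurable fun ω => infDist (m ω) (Z ω) :=
    measurable_comp_of_continuous_of_measurable (u := fun h ω => infDist h (Z ω))
      (fun ω => continuous_infDist_pt (Z ω)) (measurable_infDist_zeros hm hc h0 hz) hmeas
  refine measurable_of_unique_zero (F := fun ω h => F ω h + |dist (m ω) h - infDist (m ω) (Z ω)|)
    (fun h => (hm h).add ?_) (fun ω => (hc ω).add (by fun_prop))
    (fun ω h => add_nonneg (h0 ω h) (abs_nonneg _)) fun ω h => ?_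
  · exact ((hmeas.dist measurable_const).sub hd).norm
  · rw [add_eq_zero_iff_of_nonneg (h0 ω h) (abs_nonneg _), abs_eq_zero, sub_eq_zero]
    constructor
    · rintro ⟨hh, he⟩
      exact eq_of_dist_eq_infDist_of_convex (hconv ω) hh (hsZ ω) he.symm (hsd ω)
    · rintro rfl
      exact ⟨hsZ ω, (hsd ω).symm⟩

end zeroSet

/-! ### The damped expected shortfall -/

section shortfall

variable {E : Type*} [NormedAddCommGroup E]

/-- The vector `y / (1 + |y|)`. It lies on the ray of `y`, so that it has the same scalar product
signs as `y`, and it belongs to the unit ball, so that it is always integrable. -/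
noncomputable def damp [NormedSpace ℝ E] (y : E) : E := (1 + ‖y‖)⁻¹ • y

theorem norm_damp_le [NormedSpace ℝ E] (y : E) : ‖damp y‖ ≤ 1 := by
  have := norm_nonneg y
  rw [damp, norm_smul, norm_inv, Real.norm_of_nonneg (by positivity),
    inv_mul_le_iff₀ (by positivity)]
  linarith

theorem continuous_damp [NormedSpace ℝ E] : Continuous (damp : E → E) := by
  refine Continuous.smul (Continuous.inv₀ (by fun_prop) fun y => ?_) continuous_id
  positivity

variable [InnerProductSpace ℝ E]

theorem inner_damp (h y : E) : inner ℝ h (damp y) = (1 + ‖y‖)⁻¹ * inner ℝ h y :=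
  real_inner_smul_right _ _ _

theorem abs_inner_damp_le (h y : E) : |inner ℝ h (damp y)| ≤ ‖h‖ :=
  (abs_real_inner_le_norm _ _).trans (mul_le_of_le_one_right (norm_nonneg h) (norm_damp_le y))

theorem continuous_loss (h : E) : Continuous fun y : E => max (-inner ℝ h (damp y)) 0 :=
  ((continuous_const.inner continuous_damp).neg).max continuous_const

theorem norm_loss_le (h y : E) : ‖max (-inner ℝ h (damp y)) 0‖ ≤ ‖h‖ := by
  rw [Real.norm_of_nonneg (le_max_right _ _)]
  exact max_le ((neg_le_abs _).trans (abs_inner_damp_le h y)) (norm_nonneg h)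

variable [MeasurableSpace E]

/-- The expected loss of the position `h` when the price change has law `ν` and is damped. -/
noncomputable def shortfall (ν : Measure E) (h : E) : ℝ :=
  ∫ y, max (-inner ℝ h (damp y)) 0 ∂ν

theorem shortfall_nonneg (ν : Measure E) (h : E) : 0 ≤ shortfall ν h :=
  integral_nonneg fun _ => le_max_right _ _

theorem shortfall_zero (ν : Measure E) : shortfall ν 0 = 0 := by
  simp [shortfall]

/-- `n` bounds the shortfall at `ν`: every unit vector at distance at least `1` from the positions
without loss has shortfall greater than `1 / (n + 1)`. It is written as the absence of zeros of one
nonnegative continuous function on the sphere, a condition that depends measurably on `ν`. -/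
def ShortfallBound (ν : Measure E) (n : ℕ) : Prop :=
  ¬∃ h ∈ sphere (0 : E) 1,
    max (1 - infDist h {k | shortfall ν k = 0}) 0 + max (shortfall ν h - 1 / ((n : ℝ) + 1)) 0 = 0

theorem ShortfallBound.lt {ν : Measure E} {n : ℕ} (hn : ShortfallBound ν n) {h : E}
    (h1 : ‖h‖ = 1) (hd : 1 ≤ infDist h {k | shortfall ν k = 0}) :
    1 / ((n : ℝ) + 1) < shortfall ν h := by
  by_contra! hle
  exact hn ⟨h, by simpa using h1, by
    rw [max_eq_right (by linarith), max_eq_right (by linarith), add_zero]⟩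

variable [BorelSpace E]

theorem integrable_loss (ν : Measure E) [IsFiniteMeasure ν] (h : E) :
    Integrable (fun y => max (-inner ℝ h (damp y)) 0) ν :=
  .of_bound (continuous_loss h).aestronglyMeasurable ‖h‖ (.of_forall (norm_loss_le h))

theorem continuous_shortfall (ν : Measure E) [IsFiniteMeasure ν] : Continuous (shortfall ν) := by
  refine continuous_iff_continuousAt.2 fun h => ?_
  refine continuousAt_of_dominated (bound := fun _ => ‖h‖ + 1)
    (.of_forall fun k => (continuous_loss k).aestronglyMeasurable) ?_ (integrable_const _)
    (.of_forall fun y => ?_)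
  · filter_upwards [continuous_norm.continuousAt.eventually_lt
      (continuousAt_const (y := ‖h‖ + 1)) (lt_add_one ‖h‖)] with k hk
    exact .of_forall fun y => (norm_loss_le k y).trans hk.le
  · fun_prop

theorem measurable_shortfall {X : Type*} [MeasurableSpace X] (κ : Kernel X E) (h : E) :
    Measurable fun ω => shortfall (κ ω) h :=
  (StronglyMeasurable.integral_kernel (continuous_loss h).stronglyMeasurable).measurable

theorem shortfall_eq_zero_iff (ν : Measure E) [IsFiniteMeasure ν] (h : E) :
    shortfall ν h = 0 ↔ ∀ᵐ y ∂ν, 0 ≤ inner ℝ h y := by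
  have h0 : (0 : E → ℝ) ≤ fun y => max (-inner ℝ h (damp y)) 0 := fun _ => le_max_right _ _
  rw [shortfall, integral_eq_zero_iff_of_nonneg h0 (integrable_loss ν h)]
  refine Filter.eventually_congr (.of_forall fun y => ?_)
  have : 0 < (1 + ‖y‖)⁻¹ := by positivity
  rw [Pi.zero_apply, max_eq_right_iff, neg_nonpos, inner_damp, mul_nonneg_iff_of_pos_left this]

theorem convex_shortfall_zeros (ν : Measure E) [IsFiniteMeasure ν] :
    Convex ℝ {h | shortfall ν h = 0} := by
  intro h hh k hk a b ha hb _
  rw [Set.mem_ofPred_eq, shortfall_eq_zero_iff] at hh hk ⊢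
  filter_upwards [hh, hk] with y hy ky
  rw [inner_add_left, real_inner_smul_left, real_inner_smul_left]
  positivity

variable [FiniteDimensional ℝ E]

theorem integrable_damp (ν : Measure E) [IsFiniteMeasure ν] : Integrable (damp : E → E) ν :=
  .of_bound continuous_damp.aestronglyMeasurable 1 (.of_forall norm_damp_le)

/-- The damped loss is at most `1`, and at most `a` where `⟪h, y⟫ > -a`. -/
theorem shortfall_le_add_measureReal (ν : Measure E) [IsProbabilityMeasure ν] {h : E}
    (hh : ‖h‖ ≤ 1) {a : ℝ} (ha : 0 ≤ a) :
    shortfall ν h ≤ a + ν.real {y | inner ℝ h y ≤ -a} := by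
  have hA : MeasurableSet {y : E | inner ℝ h y ≤ -a} :=
    measurableSet_le (by fun_prop) measurable_const
  have hi := (integrable_indicator_iff hA).2 (integrable_const (μ := ν) (1 : ℝ)).integrableOn
  calc shortfall ν h
      ≤ ∫ y, (a + {y | inner ℝ h y ≤ -a}.indicator (fun _ => (1 : ℝ)) y) ∂ν := by
        refine integral_mono (integrable_loss ν h) ((integrable_const a).add hi) fun y => ?_
        by_cases hy : inner ℝ h y ≤ -a
        · have := (le_abs_self _).trans ((norm_loss_le h y).trans hh)
          simp only [Set.indicator, Set.mem_ofPred_eq, hy, if_true]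
          linarith
        · simp only [Set.indicator, Set.mem_ofPred_eq, hy, if_false, add_zero]
          refine max_le ?_ ha
          have h1 : (1 + ‖y‖)⁻¹ ≤ 1 := inv_le_one_of_one_le₀ (by linarith [norm_nonneg y])
          have h2 : 0 ≤ (1 + ‖y‖)⁻¹ := by positivity
          rw [inner_damp]
          nlinarith
    _ = a + ν.real {y | inner ℝ h y ≤ -a} := by
        rw [integral_add (integrable_const a) hi, integral_indicator_const _ hA]
        simp

/-- Let `s` be the projection of the damped mean `m` onto the convex cone of all positions `k`
without loss. If `s` has no gain, then `⟪m, s⟫ = 0`, hence `s = 0`, and `m` is in the polar cone, so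
that no position without loss has a gain. -/
theorem ae_inner_eq_zero_of_projection (ν : Measure E) [IsProbabilityMeasure ν] {s : E}
    (hs : ∀ k, shortfall ν k = 0 → inner ℝ ((∫ y, damp y ∂ν) - s) (k - s) ≤ 0)
    (hsy : ∀ᵐ y ∂ν, inner ℝ s y = 0) {k : E} (hk : shortfall ν k = 0) :
    ∀ᵐ y ∂ν, inner ℝ k y = 0 := by
  set m := ∫ y, damp y ∂ν with hm
  have hint : ∀ h : E, ∫ y, inner ℝ h (damp y) ∂ν = inner ℝ h m :=
    integral_inner (integrable_damp ν)
  have hsm : inner ℝ s m = 0 := by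
    rw [← hint]
    refine integral_eq_zero_of_ae ?_
    filter_upwards [hsy] with y hy
    rw [inner_damp, hy, mul_zero, Pi.zero_apply]
  have hs0 : s = 0 := by
    have h1 := hs 0 (shortfall_zero ν)
    rw [zero_sub, inner_neg_right, inner_sub_left, real_inner_comm, hsm,
      real_inner_self_eq_norm_sq] at h1
    have h2 : ‖s‖ = 0 := by nlinarith [norm_nonneg s]
    exact norm_eq_zero.1 h2
  have hkm := hs k hk
  rw [hs0, sub_zero, sub_zero, real_inner_comm, ← hint] at hkm
  have hky := (shortfall_eq_zero_iff ν k).1 hk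
  have hky' : 0 ≤ᵐ[ν] fun y => inner ℝ k (damp y) := by
    filter_upwards [hky] with y hy
    rw [inner_damp, Pi.zero_apply]
    positivity
  have hz := (integral_eq_zero_iff_of_nonneg_ae hky' ((integrable_damp ν).const_inner k)).1
    (le_antisymm hkm (integral_nonneg_of_ae hky'))
  filter_upwards [hz] with y hy
  have : (1 + ‖y‖)⁻¹ ≠ 0 := by positivity
  rw [inner_damp, Pi.zero_apply, mul_eq_zero] at hy
  exact hy.resolve_left this

theorem exists_shortfallBound (ν : Measure E) [IsFiniteMeasure ν] : ∃ n, ShortfallBound ν n := by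
  have : ProperSpace E := FiniteDimensional.proper_real E
  let C := sphere (0 : E) 1 ∩ {h | 1 ≤ infDist h {k | shortfall ν k = 0}}
  have hC : IsCompact C :=
    (isCompact_sphere 0 1).inter_right (isClosed_le continuous_const (continuous_infDist_pt _))
  rcases C.eq_empty_or_nonempty with he | hne
  · refine ⟨0, fun ⟨h, hh, hz⟩ => ?_⟩
    rw [add_eq_zero_iff_of_nonneg (le_max_right _ _) (le_max_right _ _)] at hz
    have : h ∈ C := ⟨hh, by simpa using hz.1⟩
    simp [he] at this
  · obtain ⟨c, hc, hmin⟩ := hC.exists_isMinOn hne (continuous_shortfall ν).continuousOn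
    have hpos : 0 < shortfall ν c := by
      refine (shortfall_nonneg ν c).lt_of_ne fun h0 => ?_
      have h1 : (1 : ℝ) ≤ infDist c {k | shortfall ν k = 0} := hc.2
      rw [infDist_zero_of_mem (show c ∈ {k | shortfall ν k = 0} from h0.symm)] at h1
      linarith
    obtain ⟨n, hn⟩ := exists_nat_one_div_lt hpos
    refine ⟨n, fun ⟨h, hh, hz⟩ => ?_⟩
    rw [add_eq_zero_iff_of_nonneg (le_max_right _ _) (le_max_right _ _)] at hz
    have h1 : h ∈ C := ⟨hh, by simpa using hz.1⟩
    have h2 := hmin h1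
    have h3 : shortfall ν h ≤ 1 / ((n : ℝ) + 1) := by simpa using hz.2
    simp only [Set.mem_ofPred_eq] at h2
    linarith

/-- The constant `a = 1 / (2 (n + 1))` satisfies `2 a < shortfall ≤ a + ν (⟪u, y⟫ ≤ -a)` at
`u = h / |h|`: since `u` is orthogonal to the set of positions without loss, which contains `0`, its
distance to that set is `1`. -/
theorem ShortfallBound.le_measureReal {ν : Measure E} [IsProbabilityMeasure ν] {n : ℕ}
    (hn : ShortfallBound ν n) {h : E} (horth : ∀ k, shortfall ν k = 0 → inner ℝ k h = 0) :
    1 / (2 * ((n : ℝ) + 1)) ≤ ν.real {y | inner ℝ h y ≤ -(1 / (2 * ((n : ℝ) + 1))) * ‖h‖} := by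
  set a := 1 / (2 * ((n : ℝ) + 1)) with ha
  have ha0 : 0 ≤ a := by positivity
  have ha2 : 1 / ((n : ℝ) + 1) = a + a := by rw [ha]; field_simp; norm_num
  rcases eq_or_ne h 0 with rfl | hh
  · have ha1 : a ≤ 1 := by
      rw [ha, div_le_one (by positivity)]
      linarith [(Nat.cast_nonneg n : (0 : ℝ) ≤ n)]
    simpa using ha1
  have hpos : 0 < ‖h‖ := norm_pos_iff.2 hh
  set u := ‖h‖⁻¹ • h with hu
  have hu1 : ‖u‖ = 1 := norm_smul_inv_norm (𝕜 := ℝ) hh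
  have hd : 1 ≤ infDist u {k | shortfall ν k = 0} := by
    refine (le_infDist (s := {k | shortfall ν k = 0}) ⟨0, shortfall_zero ν⟩).2 fun k hk => ?_
    have h0 : inner ℝ u k = 0 := by
      rw [hu, real_inner_smul_left, real_inner_comm, horth k hk, mul_zero]
    have h1 := norm_sub_sq_real u k
    rw [h0, hu1] at h1
    rw [dist_eq_norm]
    nlinarith [norm_nonneg (u - k), sq_nonneg ‖k‖]
  have h1 := hn.lt hu1 hd
  have h2 := shortfall_le_add_measureReal ν hu1.le ha0
  have h3 : {y | inner ℝ u y ≤ -a} = {y | inner ℝ h y ≤ -a * ‖h‖} := by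
    ext y
    rw [Set.mem_ofPred_eq, Set.mem_ofPred_eq, hu, real_inner_smul_left, inv_mul_le_iff₀ hpos,
      mul_comm]
  rw [← h3]
  linarith

theorem measurableSet_shortfallBound {X : Type*} [MeasurableSpace X] (κ : Kernel X E)
    [IsMarkovKernel κ] (n : ℕ) :
    MeasurableSet {ω | ShortfallBound (κ ω) n} := by
  have : ProperSpace E := FiniteDimensional.proper_real E
  refine (measurableSet_exists_mem_eq_zero (F := fun ω h =>
      max (1 - infDist h {k | shortfall (κ ω) k = 0}) 0 +
        max (shortfall (κ ω) h - 1 / ((n : ℝ) + 1)) 0)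
    (fun h => ?_) (fun ω => ?_) (fun ω h => by positivity) (isCompact_sphere (0 : E) 1)).compl
  · exact ((measurable_const.sub (measurable_infDist_zeros (measurable_shortfall κ)
      (fun ω => continuous_shortfall _) (fun ω => shortfall_nonneg _)
      (fun ω => ⟨0, shortfall_zero _⟩) h)).max measurable_const).add
      (((measurable_shortfall κ h).sub measurable_const).max measurable_const)
  · exact ((continuous_const.sub (continuous_infDist_pt _)).max continuous_const).add
      (((continuous_shortfall _).sub continuous_const).max continuous_const)

end shortfall

/-! ### One-period consequences of the no-arbitrage condition -/

section market

variable {Ω : ℕ → Type*} {t : ℕ}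

theorem UnivMeasurable.of_measurable {X Y : Type*} [MeasurableSpace X] [MeasurableSpace Y]
    {f : X → Y} (hf : Measurable f) : UnivMeasurable f :=
  fun _ hs _ => (hf hs).nullMeasurableSet

theorem Path.past_snoc {s : ℕ} (h : s ≤ t) (ω : Path Ω t) (x : Ω t) :
    (ω.snoc x).past (h.trans t.le_succ) = ω.past h := by
  ext i
  exact Fin.snoc_castSucc (α := fun i : Fin (t + 1) => Ω i) x ω ⟨i, i.isLt.trans_le h⟩

theorem Path.past_self (ω : Path Ω t) : ω.past le_rfl = ω := rfl

theorem Path.snoc_last (ω : Path Ω t) (x : Ω t) : ω.snoc x (Fin.last t) = x :=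
  Fin.snoc_last (α := fun i : Fin (t + 1) => Ω i) x ω

variable [∀ i, MeasurableSpace (Ω i)]

theorem Path.measurable_past {s : ℕ} (h : s ≤ t) : Measurable (Path.past (Ω := Ω) h) :=
  measurable_pi_lambda _ fun _ => measurable_pi_apply _

theorem ae_prodKernel_iff [MeasurableSpace.CountablyGenerated (Ω t)]
    (μ : Measure (Path Ω t)) [IsProbabilityMeasure μ] {p : Path Ω t → ProbabilityMeasure (Ω t)}
    (hp : UnivMeasurable p) {A : Set (Path Ω (t + 1))} (hA : MeasurableSet A) :
    (∀ᵐ η ∂prodKernel μ p, η ∈ A) ↔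
      ∀ᵐ ω ∂μ, ∀ᵐ x ∂(p ω : Measure (Ω t)), ω.snoc x ∈ A := by
  have h2 : ∀ ω : Path Ω t, Measurable (ω.snoc : Ω t → Path Ω (t + 1)) := fun ω =>
    Path.measurable_snoc.comp measurable_prodMk_left
  have hm : AEMeasurable (fun ω => (p ω : Measure (Ω t)).map ω.snoc Aᶜ) μ :=
    (Measure.measurable_coe hA.compl).comp_aemeasurable (Path.aemeasurable_map_snoc μ hp)
  rw [ae_iff, show {η | η ∉ A} = Aᶜ from rfl, prodKernel,
    Measure.bind_apply hA.compl (Path.aemeasurable_map_snoc μ hp), lintegral_eq_zero_iff' hm]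
  refine Filter.eventually_congr (.of_forall fun ω => ?_)
  beta_reduce
  rw [Pi.zero_apply, Measure.map_apply (h2 ω) hA.compl, ae_iff]
  rfl

/-- `P_t` is the marginal law of `P_s` on `Ω^t`. -/
theorem law_preimage_past [∀ i, MeasurableSpace.CountablyGenerated (Ω i)]
    {q : ∀ t, Path Ω t → ProbabilityMeasure (Ω t)} {s : ℕ} (h : t ≤ s)
    (hq : ∀ r < s, UnivMeasurable (q r)) {A : Set (Path Ω t)} (hA : MeasurableSet A) :
    law q s (Path.past h ⁻¹' A) = law q t A := by
  induction s, h using Nat.le_induction with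
  | base => rfl
  | succ s h ih =>
    have hq' : ∀ r < s, UnivMeasurable (q r) := fun r hr => hq r (hr.trans s.lt_succ_self)
    have := isProbabilityMeasure_law q s hq'
    rw [law, prodKernel_apply _ (hq s s.lt_succ_self) (Path.measurable_past _ hA), ← ih hq',
      ← lintegral_indicator_one (Path.measurable_past h hA)]
    refine lintegral_congr fun ω => ?_
    simp only [Set.mem_preimage, Path.past_snoc h]
    by_cases hω : ω.past h ∈ A <;> simp [Set.indicator, hω]

variable {d : ℕ} {S : ∀ t, Path Ω t → EuclideanSpace ℝ (Fin d)}

theorem measurable_increment (h0 : Measurable (S t)) (h1 : Measurable (S (t + 1))) :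
    Measurable fun z : Path Ω t × Ω t => increment S z.1 z.2 :=
  (h1.comp Path.measurable_snoc).sub (h0.comp measurable_fst)

/-- The market restricted to the period from `t` to `t + 1` is free of arbitrage: a measurable
position `s` at time `t` is extended to a strategy which trades in that period only. -/
theorem StrongNoArbitrage.ae_inner_increment_eq_zero
    [∀ i, MeasurableSpace.CountablyGenerated (Ω i)] {T : ℕ}
    {𝒬 : ∀ t, Path Ω t → Set (ProbabilityMeasure (Ω t))}
    (hNA : StrongNoArbitrage T 𝒬 S) (hS : ∀ t ≤ T, Measurable (S t))
    {q : ∀ t, Path Ω t → ProbabilityMeasure (Ω t)} (hq : IsSelection T 𝒬 q) (ht : t < T)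
    {s : Path Ω t → EuclideanSpace ℝ (Fin d)} (hs : Measurable s)
    (h : ∀ᵐ ω ∂law q t, ∀ᵐ x ∂(q t ω : Measure (Ω t)), 0 ≤ inner ℝ (s ω) (increment S ω x)) :
    ∀ᵐ ω ∂law q t, ∀ᵐ x ∂(q t ω : Measure (Ω t)), inner ℝ (s ω) (increment S ω x) = 0 := by
  have := isProbabilityMeasure_law q t fun r hr => hq.univMeasurable r (hr.trans ht)
  let f : Path Ω (t + 1) → ℝ := fun η =>
    inner ℝ (s (η.past t.le_succ)) (increment S (η.past t.le_succ) (η (Fin.last t)))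
  have hpast := Path.measurable_past (Ω := Ω) t.le_succ
  have hf : Measurable f := (hs.comp hpast).inner
    ((measurable_increment (hS t ht.le) (hS (t + 1) ht)).comp
      (hpast.prodMk (measurable_pi_apply (Fin.last t))))
  have hfs : ∀ (ω : Path Ω t) (x : Ω t), f (ω.snoc x) = inner ℝ (s ω) (increment S ω x) :=
    fun ω x => by
      simp only [f, Path.past_snoc le_rfl, Path.past_self, Path.snoc_last]
  let φ : ∀ r, Path Ω r → EuclideanSpace ℝ (Fin d) := Function.update (fun _ _ => 0) t s
  have hφt : φ t = s := Function.update_self ..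
  have hφ : ∀ r, r ≠ t → φ r = fun _ => 0 := fun r hr => Function.update_of_ne hr ..
  have hφm : IsStrategy T φ := fun r _ => by
    rcases eq_or_ne r t with rfl | hr
    · rw [hφt]
      exact .of_measurable hs
    · rw [hφ r hr]
      exact .of_measurable measurable_const
  have hV : ∀ ω : Path Ω T, portfolioValue S φ 0 T ω = f (ω.past ht) := fun ω => by
    rw [portfolioValue, zero_add, Finset.sum_eq_single ⟨t, ht⟩]
    · simp only [hφt]
      rfl
    · intro r _ hr
      rw [hφ r fun h => hr (Fin.ext h), inner_zero_left]
    · simp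
  -- Events that depend on `f` only are transferred from `P_T` to `P_{t+1} = P_t ⊗ q_{t+1}`.
  have htr : ∀ {B : Set ℝ}, MeasurableSet B → ((∀ᵐ ω ∂law q T, portfolioValue S φ 0 T ω ∈ B) ↔
      ∀ᵐ ω ∂law q t, ∀ᵐ x ∂(q t ω : Measure (Ω t)), inner ℝ (s ω) (increment S ω x) ∈ B) := by
    intro B hB
    simp_rw [hV, ← hfs]
    refine Iff.trans ?_ (ae_prodKernel_iff (law q t) (hq.univMeasurable t ht) (hf hB))
    rw [ae_iff, ae_iff]
    exact (law_preimage_past (s := T) ht hq.univMeasurable (hf hB).compl).congr_left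
  exact (htr (measurableSet_singleton 0)).1
    (hNA _ ⟨q, hq, rfl⟩ φ hφm ((htr measurableSet_Ici).2 h))

/-- The conditional law of `ΔS_{t+1}` given `ω^t`, for a Borel version of the kernel on `Ω_{t+1}`. -/
noncomputable def incrementKernel (p : Path Ω t → ProbabilityMeasure (Ω t)) (hp : Measurable p)
    (h0 : Measurable (S t)) (h1 : Measurable (S (t + 1))) :
    Kernel (Path Ω t) (EuclideanSpace ℝ (Fin d)) where
  toFun ω := (p ω : Measure (Ω t)).map (increment S ω)
  measurable' := by
    let κ : Kernel (Path Ω t) (Ω t) :=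
      ⟨fun ω => (p ω : Measure (Ω t)), measurable_subtype_coe.comp hp⟩
    have hκ : IsMarkovKernel κ := ⟨fun ω => (p ω).2⟩
    have hi := measurable_increment h0 h1
    refine Measure.measurable_of_measurable_coe _ fun A hA => ?_
    have h2 : ∀ ω : Path Ω t, Measurable (increment S ω) := fun ω =>
      hi.comp measurable_prodMk_left
    simp_rw [Measure.map_apply (h2 _) hA]
    exact Kernel.measurable_kernel_prodMk_left (κ := κ) (hi hA)

/-- The orthogonal complement of `k` is one of the closed sets whose intersection spans
`D_P^{t+1}`. -/
theorem inner_eq_zero_of_mem_supportHull {q : ∀ t, Path Ω t → ProbabilityMeasure (Ω t)}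
    {ω : Path Ω t} {k h : EuclideanSpace ℝ (Fin d)}
    (hk : ∀ᵐ x ∂(q t ω : Measure (Ω t)), inner ℝ k (increment S ω x) = 0)
    (hh : h ∈ supportHull S q t ω) : inner ℝ k h = 0 := by
  let W := (innerSL ℝ k).ker
  have hle : supportHull S q t ω ≤ W.toAffineSubspace := by
    refine affineSpan_le.2 (Set.sInter_subset_of_mem ⟨(innerSL ℝ k).isClosed_ker, ?_⟩)
    exact (measure_congr (Filter.eventuallyEq_univ.2 hk)).trans measure_univ
  exact hle hh

end market

end RobustMarket

open RobustMarket ProbabilityTheory in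
theorem proposition2p3 {Ω : ℕ → Type*} [∀ i, TopologicalSpace (Ω i)] [∀ i, PolishSpace (Ω i)]
    [∀ i, MeasurableSpace (Ω i)] [∀ i, BorelSpace (Ω i)] {d : ℕ} (T : ℕ)
    (𝒬 : ∀ t, RobustMarket.Path Ω t → Set (ProbabilityMeasure (Ω t)))
    (h𝒬 : RobustMarket.IsAdmissiblePriors T 𝒬)
    (S : ∀ t, RobustMarket.Path Ω t → EuclideanSpace ℝ (Fin d))
    (hS : ∀ t ≤ T, Measurable (S t))
    (hNA : RobustMarket.StrongNoArbitrage T 𝒬 S)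
    (q : ∀ t, RobustMarket.Path Ω t → ProbabilityMeasure (Ω t))
    (hq : RobustMarket.IsSelection T 𝒬 q)
    (t : ℕ) (ht : t < T) :
    ∃ (Ω_P : Set (RobustMarket.Path Ω t)) (α : RobustMarket.Path Ω t → ℝ),
      MeasurableSet Ω_P ∧ RobustMarket.law q t Ω_P = 1 ∧
      Measurable α ∧ (∀ ω, α ω ∈ Set.Ioc 0 1) ∧
      ∀ ω ∈ Ω_P, ∀ h ∈ RobustMarket.supportHull S q t ω,
        α ω ≤ (q t ω : Measure (Ω t)).real
          {x | inner ℝ h (RobustMarket.increment S ω x) ≤ -α ω * ‖h‖} := by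
  classical
  have := isProbabilityMeasure_law q t fun r hr => hq.univMeasurable r (hr.trans ht)
  have h0 := hS t ht.le
  have h1 := hS (t + 1) ht
  have hinc : ∀ ω : Path Ω t, Measurable (increment S ω) := fun ω =>
    (measurable_increment h0 h1).comp measurable_prodMk_left
  -- `p` is a Borel version of `q_{t+1}` and `κ ω` is the law of `ΔS_{t+1}(ω, ·)` under `p ω`.
  obtain ⟨p, hp, hqp⟩ := (hq.univMeasurable t ht).aemeasurable_kernel (law q t)
  let κ := incrementKernel p hp h0 h1
  have hκ : ∀ ω, κ ω = (p ω : Measure (Ω t)).map (increment S ω) := fun _ => rfl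
  have hκp : IsMarkovKernel κ :=
    ⟨fun ω => Measure.isProbabilityMeasure_map (hinc ω).aemeasurable⟩
  have hκae : ∀ ω k (B : Set ℝ), MeasurableSet B → ((∀ᵐ y ∂κ ω, inner ℝ k y ∈ B) ↔
      ∀ᵐ x ∂(p ω : Measure (Ω t)), inner ℝ k (increment S ω x) ∈ B) := fun ω k B hB => by
    rw [hκ]
    exact ae_map_iff (hinc ω).aemeasurable
      ((measurable_const.inner measurable_id : Measurable fun y => inner ℝ k y) hB)
  -- `s ω` is the projection of the damped mean onto the positions without loss; it is a strategy
  -- for one period, to which the no-arbitrage condition applies.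
  obtain ⟨s, hsm, hs0, hsproj⟩ := exists_measurable_projection_zeros (measurable_shortfall κ)
    (fun ω => continuous_shortfall _) (fun ω => shortfall_nonneg _)
    (fun ω => ⟨0, shortfall_zero _⟩) (fun ω => convex_shortfall_zeros _)
    (StronglyMeasurable.integral_kernel (κ := κ) continuous_damp.stronglyMeasurable).measurable
  have hs : ∀ᵐ ω ∂law q t, ∀ᵐ x ∂(q t ω : Measure (Ω t)),
      inner ℝ (s ω) (increment S ω x) = 0 := by
    refine hNA.ae_inner_increment_eq_zero hS hq ht hsm ?_
    filter_upwards [hqp] with ω hω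
    rw [hω]
    exact (hκae ω _ _ measurableSet_Ici).1 ((shortfall_eq_zero_iff _ _).1 (hs0 ω))
  -- Absence of arbitrage for the single strategy `s` yields it, pathwise, for all positions `k`.
  have hgood : ∀ᵐ ω ∂law q t, q t ω = p ω ∧
      ∀ k, shortfall (κ ω) k = 0 → ∀ᵐ y ∂κ ω, inner ℝ k y = 0 := by
    filter_upwards [hqp, hs] with ω hω hsω
    rw [hω] at hsω
    exact ⟨hω, fun k hk => ae_inner_eq_zero_of_projection _ (hsproj ω)
      ((hκae ω _ _ (measurableSet_singleton 0)).2 hsω) hk⟩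
  obtain ⟨Ω_P, hΩae, hΩm, hΩ⟩ := hgood.exists_measurable_mem
  have hex : ∀ ω, ∃ n, ShortfallBound (κ ω) n := fun ω => exists_shortfallBound _
  refine ⟨Ω_P, fun ω => 1 / (2 * ((Nat.find (hex ω) : ℝ) + 1)), hΩm,
    mem_ae_iff_prob_eq_one hΩm |>.1 hΩae, ?_, fun ω => ⟨by positivity, ?_⟩, fun ω hω h hh => ?_⟩
  · have hN := measurable_find hex (measurableSet_shortfallBound κ)
    exact (measurable_from_nat (f := fun n : ℕ => 1 / (2 * ((n : ℝ) + 1)))).comp hN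
  · rw [div_le_one (by positivity)]
    linarith [(Nat.cast_nonneg (Nat.find (hex ω)) : (0 : ℝ) ≤ _)]
  · obtain ⟨hqω, hK⟩ := hΩ ω hω
    have key := (Nat.find_spec (hex ω)).le_measureReal (h := h) fun k hk =>
      inner_eq_zero_of_mem_supportHull
        (by rw [hqω]; exact (hκae ω k _ (measurableSet_singleton 0)).1 (hK k hk)) hh
    beta_reduce
    generalize Nat.find (hex ω) = n at key ⊢
    rw [hκ, map_measureReal_apply (hinc ω) (measurableSet_le (by fun_prop) measurable_const)] at key
    rw [hqω]
    exact key
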